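/- For $m,n,r,s,\kappa\in\mathbb{N}=\{1,2,\ldots\}$ let $N(m,n,r,s;\kappa)$ denote the number of subgroups of order $\kappa$ of the group $\mathbb{Z}_m\times\mathbb{Z}_n\times\mathbb{Z}_r\times\mathbb{Z}_s$, let $F(m,n)$ denote the number of automorphisms of the group $\mathbb{Z}_m\times\mathbb{Z}_n$, and let $\varphi$ be Euler's function. Then for every prime $p$ and all $a,b,c,d,k\in\mathbb{N}_0=\{0,1,2,\ldots\}$ with $k\le a+b+c+d$ we have $$N(p^a,p^b,p^c,p^d;p^k)=\sum \varphi(p^{x_3})\,\varphi(p^{y_3})\,\varphi(p^{z_3})\,\varphi(p^{t_3})\,F(p^u,p^v),$$ where the (finite) sum is over all $$(x_1,x_2,x_3,x_4,x_5,y_1,y_2,y_3,y_4,y_5,z_1,z_2,z_3,z_4,z_5,t_1,t_2,t_3,t_4,t_5)\in\mathbb{N}_0^{20}$$ satisfying the following 11 conditions: (i) $x_1+x_2+x_3=a$, (ii) $x_3+x_4+x_5=b$, (iii) $y_1+y_2+y_3=\min(x_1,x_4)$, (iv) $y_3+y_4+y_5=x_3+\max(x_1,x_4)$, (v) $z_1+z_2+z_3=c$,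 (vi) $z_3+z_4+z_5=d$, (vii) $t_1+t_2+t_3=\min(z_1,z_4)$, (viii) $t_3+t_4+t_5=z_3+\max(z_1,z_4)$, (ix) $\min(y_2,y_5)=\min(t_2,t_5)=:u$, (x) $y_3+\max(y_2,y_5)=t_3+\max(t_2,t_5)=:v$, (xi) $x_1+x_3+x_4+t_1+t_3+t_4=k$. -/

import Mathlib

/-- `N(m,n,r,s;k)`: the number of subgroups of order `k` of the group
`ℤ_m × ℤ_n × ℤ_r × ℤ_s` (used for positive `m, n, r, s`). -/
noncomputable def numSubgroupsOfOrder (m n r s k : ℕ) : ℕ :=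
  Nat.card {H : AddSubgroup (ZMod m × ZMod n × ZMod r × ZMod s) // Nat.card H = k}

/-- `F(u,v)`: the number of automorphisms of the group `ℤ_u × ℤ_v` (used for positive `u, v`). -/
noncomputable def numAutomorphisms (u v : ℕ) : ℕ :=
  Nat.card (AddAut (ZMod u × ZMod v))

/-- A tuple `(x₁,…,x₅, y₁,…,y₅, z₁,…,z₅, t₁,…,t₅)` of twenty nonnegative integers. -/
@[ext]
structure ExponentTuple where
  (x₁ x₂ x₃ x₄ x₅ : ℕ)
  (y₁ y₂ y₃ y₄ y₅ : ℕ)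
  (z₁ z₂ z₃ z₄ z₅ : ℕ)
  (t₁ t₂ t₃ t₄ t₅ : ℕ)

namespace ExponentTuple

/-- The common value `u` of both sides of condition (ix) below. -/
def u (w : ExponentTuple) : ℕ := min w.y₂ w.y₅

/-- The common value `v` of both sides of condition (x) below. -/
def v (w : ExponentTuple) : ℕ := w.y₃ + max w.y₂ w.y₅

/-- The ten conditions on the summation tuples. -/
structure Admissible (a b c d : ℕ) (w : ExponentTuple) : Prop where
  i : w.x₁ + w.x₂ + w.x₃ = a
  ii : w.x₃ + w.x₄ + w.x₅ = b
  iii : w.y₁ + w.y₂ + w.y₃ = min w.x₁ w.x₄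
  iv : w.y₃ + w.y₄ + w.y₅ = w.x₃ + max w.x₁ w.x₄
  v : w.z₁ + w.z₂ + w.z₃ = c
  vi : w.z₃ + w.z₄ + w.z₅ = d
  vii : w.t₁ + w.t₂ + w.t₃ = min w.z₁ w.z₄
  viii : w.t₃ + w.t₄ + w.t₅ = w.z₃ + max w.z₁ w.z₄
  ix : min w.y₂ w.y₅ = min w.t₂ w.t₅
  x : w.y₃ + max w.y₂ w.y₅ = w.t₃ + max w.t₂ w.t₅

/-- The entries of a tuple as a vector (used only for the finiteness proof below). -/
def toVec (w : ExponentTuple) : Fin 20 → ℕ :=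
  ![w.x₁, w.x₂, w.x₃, w.x₄, w.x₅, w.y₁, w.y₂, w.y₃, w.y₄, w.y₅,
    w.z₁, w.z₂, w.z₃, w.z₄, w.z₅, w.t₁, w.t₂, w.t₃, w.t₄, w.t₅]

theorem toVec_injective : Function.Injective toVec := by
  intro w w' h
  have h' := fun i => congrFun h i
  simp only [toVec] at h'
  ext
  exacts [h' 0, h' 1, h' 2, h' 3, h' 4, h' 5, h' 6, h' 7, h' 8, h' 9,
    h' 10, h' 11, h' 12, h' 13, h' 14, h' 15, h' 16, h' 17, h' 18, h' 19]

theorem finite_admissible (a b c d : ℕ) : {w : ExponentTuple | w.Admissible a b c d}.Finite := by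
  refine ((Set.finite_Iic (fun _ : Fin 20 => a + b + c + d)).preimage
    toVec_injective.injOn).subset ?_
  rintro w ⟨h1, h2, h3, h4, h5, h6, h7, h8, -, -⟩
  intro i
  fin_cases i <;> simp [toVec] <;> omega

end ExponentTuple

/-- The finite set of all tuples in `ℕ₀²⁰` that satisfy the ten conditions. -/
noncomputable def admissibleTuples (a b c d : ℕ) : Finset ExponentTuple :=
  (ExponentTuple.finite_admissible a b c d).toFinset

/-! By Goursat's lemma a subgroup `L` of `G × H` is the same as sections `A ⧸ B` of `G` and `C ⧸ D`
of `H` with an isomorphism between them, and `|L| = |A| * |D|`. The lemma is used at two levels.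
With rank-two factors `G = ℤ_{p^a} × ℤ_{p^b}` and `H = ℤ_{p^c} × ℤ_{p^d}`, it turns the count into a
sum over `A`, `B`, `C`, `D` of the number of isomorphisms `A ⧸ B ≃+ C ⧸ D`
(`card_addSubgroup_prod`). With cyclic factors it evaluates each of the four sums
(`sum_addSubgroup_of_rank_two`). A subgroup of a cyclic `p`-group is determined by its order, so a
datum amounts to five exponents `x₁, …, x₅` and one of `φ(p^{x₃})` isomorphisms. These exponents
determine the types of both the subgroup, from `x₁, x₄`, and the quotient, from `x₂, x₅`. The type
of `A` is the ambient group for `B`, likewise `C` for `D`. The types of `A ⧸ B` and `C ⧸ D` must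
agree, and then there are `F(p^u, p^v)` isomorphisms. -/

section Goursat

/-! ### Goursat's lemma. -/

variable {G H : Type*} [AddCommGroup G] [AddCommGroup H]

/-- The subgroup of `G × H` attached to sections `A / B` of `G`, `C / D` of `H` and an isomorphism
between them. -/
def goursatSubgroup (A : AddSubgroup G) (B : AddSubgroup A) (C : AddSubgroup H)
    (D : AddSubgroup C) (e : A ⧸ B ≃+ C ⧸ D) : AddSubgroup (G × H) where
  carrier := {x | ∃ (a : A) (c : C), e (a : A ⧸ B) = (c : C ⧸ D) ∧ (a : G) = x.1 ∧ (c : H) = x.2}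
  zero_mem' := ⟨0, 0, by simp, rfl, rfl⟩
  add_mem' := by
    rintro x y ⟨a, c, h, h1, h2⟩ ⟨a', c', h', h1', h2'⟩
    exact ⟨a + a', c + c', by simp [h, h'], by simp [h1, h1'], by simp [h2, h2']⟩
  neg_mem' := by
    rintro x ⟨a, c, h, h1, h2⟩
    exact ⟨-a, -c, by simp [h], by simp [h1], by simp [h2]⟩

section

variable {A : AddSubgroup G} {B : AddSubgroup A} {C : AddSubgroup H} {D : AddSubgroup C}
  {e : A ⧸ B ≃+ C ⧸ D}

theorem mem_goursatSubgroup {x : G × H} : x ∈ goursatSubgroup A B C D e ↔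
    ∃ (a : A) (c : C), e (a : A ⧸ B) = (c : C ⧸ D) ∧ (a : G) = x.1 ∧ (c : H) = x.2 :=
  Iff.rfl

theorem coe_mem_goursatSubgroup {a : A} {c : C} :
    ((a : G), (c : H)) ∈ goursatSubgroup A B C D e ↔ e (a : A ⧸ B) = (c : C ⧸ D) := by
  rw [mem_goursatSubgroup]
  constructor
  · rintro ⟨a', c', h, h1, h2⟩
    obtain rfl : a' = a := Subtype.ext h1
    obtain rfl : c' = c := Subtype.ext h2
    exact h
  · exact fun h => ⟨a, c, h, rfl, rfl⟩

theorem exists_mk_eq_apply (e : A ⧸ B ≃+ C ⧸ D) (a : A) :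
    ∃ c : C, e (a : A ⧸ B) = (c : C ⧸ D) := by
  obtain ⟨c, hc⟩ := QuotientAddGroup.mk_surjective (e (a : A ⧸ B))
  exact ⟨c, hc.symm⟩

theorem exists_apply_mk_eq (e : A ⧸ B ≃+ C ⧸ D) (c : C) :
    ∃ a : A, e (a : A ⧸ B) = (c : C ⧸ D) := by
  obtain ⟨a, ha⟩ := QuotientAddGroup.mk_surjective (e.symm (c : C ⧸ D))
  exact ⟨a, by rw [ha, e.apply_symm_apply]⟩

theorem map_fst_goursatSubgroup :
    (goursatSubgroup A B C D e).map (AddMonoidHom.fst G H) = A := by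
  ext g
  simp only [AddSubgroup.mem_map, AddMonoidHom.coe_fst, Prod.exists, exists_and_right,
    exists_eq_right]
  constructor
  · rintro ⟨h, a, c, -, rfl, -⟩
    exact a.2
  · intro hg
    obtain ⟨c, hc⟩ := exists_mk_eq_apply e ⟨g, hg⟩
    exact ⟨c, _, c, hc, rfl, rfl⟩

theorem map_snd_goursatSubgroup :
    (goursatSubgroup A B C D e).map (AddMonoidHom.snd G H) = C := by
  ext h
  simp only [AddSubgroup.mem_map, AddMonoidHom.coe_snd, Prod.exists, exists_eq_right]
  constructor
  · rintro ⟨g, a, c, -, -, rfl⟩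
    exact c.2
  · intro hh
    obtain ⟨a, ha⟩ := exists_apply_mk_eq e ⟨h, hh⟩
    exact ⟨a, a, _, ha, rfl, rfl⟩

theorem coe_zero_mem_goursatSubgroup {a : A} :
    ((a : G), (0 : H)) ∈ goursatSubgroup A B C D e ↔ a ∈ B := by
  have := coe_mem_goursatSubgroup (e := e) (a := a) (c := 0)
  simpa using this

theorem zero_coe_mem_goursatSubgroup {c : C} :
    ((0 : G), (c : H)) ∈ goursatSubgroup A B C D e ↔ c ∈ D := by
  have := coe_mem_goursatSubgroup (e := e) (a := 0) (c := c)
  rw [QuotientAddGroup.mk_zero, map_zero, eq_comm, QuotientAddGroup.eq_zero_iff] at this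
  exact this

/-- The fibre of the first projection over `a ∈ A` is a coset of `D`; `s` chooses a representative
of it. -/
theorem card_goursatSubgroup :
    Nat.card (goursatSubgroup A B C D e) = Nat.card A * Nat.card D := by
  choose s hs using exists_mk_eq_apply e
  rw [← Nat.card_prod]
  symm
  refine Nat.card_eq_of_bijective
    (fun x : A × D => (⟨((x.1 : G), ((s x.1 + x.2 : C) : H)),
      coe_mem_goursatSubgroup.2 (by simp [hs])⟩ : goursatSubgroup A B C D e)) ⟨?_, ?_⟩
  · rintro ⟨a, d⟩ ⟨a', d'⟩ h
    simp only [Subtype.mk.injEq, Prod.mk.injEq] at h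
    obtain ⟨h1, h2⟩ := h
    obtain rfl : a = a' := Subtype.ext h1
    have := Subtype.ext h2
    simpa using this
  · rintro ⟨x, a, c, h, h1, h2⟩
    have hd : -s a + c ∈ D := by
      rw [← QuotientAddGroup.eq, ← h, hs]
    refine ⟨(a, ⟨-s a + c, hd⟩), Subtype.ext (Prod.ext h1 ?_)⟩
    simp [← h2]

theorem swap_mem_goursatSubgroup_symm {x : G × H} :
    x.swap ∈ goursatSubgroup C D A B e.symm ↔ x ∈ goursatSubgroup A B C D e := by
  simp only [mem_goursatSubgroup, Prod.fst_swap, Prod.snd_swap]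
  constructor
  · rintro ⟨c, a, h, h1, h2⟩
    exact ⟨a, c, by rw [← h, e.apply_symm_apply], h2, h1⟩
  · rintro ⟨a, c, h, h1, h2⟩
    exact ⟨c, a, by rw [← h, e.symm_apply_apply], h2, h1⟩

theorem map_prodComm_goursatSubgroup :
    (goursatSubgroup A B C D e).map (AddEquiv.prodComm : G × H ≃+ H × G).toAddMonoidHom =
      goursatSubgroup C D A B e.symm := by
  ext x
  constructor
  · rintro ⟨y, hy, rfl⟩
    exact swap_mem_goursatSubgroup_symm.2 hy
  · intro hx
    exact ⟨x.swap, swap_mem_goursatSubgroup_symm.1 (by simpa using hx), by simp⟩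

end

/-- Two sections, one in each group, together with an isomorphism between them. -/
abbrev GoursatDatum (G H : Type*) [AddCommGroup G] [AddCommGroup H] :=
  Σ (A : AddSubgroup G) (B : AddSubgroup A) (C : AddSubgroup H) (D : AddSubgroup C),
    (A ⧸ B ≃+ C ⧸ D)

/-- **Goursat's lemma**: every subgroup of `G × H` comes from a unique datum. -/
theorem goursatSubgroup_bijective : Function.Bijective
    (fun q : GoursatDatum G H => goursatSubgroup q.1 q.2.1 q.2.2.1 q.2.2.2.1 q.2.2.2.2) := by
  constructor
  · rintro ⟨A, B, C, D, e⟩ ⟨A', B', C', D', e'⟩ h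
    simp only at h
    obtain rfl : A = A' := by
      rw [← map_fst_goursatSubgroup (e := e), h, map_fst_goursatSubgroup]
    obtain rfl : C = C' := by
      rw [← map_snd_goursatSubgroup (e := e), h, map_snd_goursatSubgroup]
    obtain rfl : B = B' := by
      ext a
      rw [← coe_zero_mem_goursatSubgroup (e := e), h, coe_zero_mem_goursatSubgroup]
    obtain rfl : D = D' := by
      ext c
      rw [← zero_coe_mem_goursatSubgroup (e := e), h, zero_coe_mem_goursatSubgroup]
    obtain rfl : e = e' := by
      ext x
      obtain ⟨a, rfl⟩ := QuotientAddGroup.mk_surjective x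
      obtain ⟨c, hc⟩ := exists_mk_eq_apply e a
      rw [hc]
      rw [← coe_mem_goursatSubgroup, h, coe_mem_goursatSubgroup] at hc
      exact hc.symm
    rfl
  · intro L
    let A := L.map (AddMonoidHom.fst G H)
    let C := L.map (AddMonoidHom.snd G H)
    let B : AddSubgroup A := (L.comap (AddMonoidHom.inl G H)).addSubgroupOf A
    let D : AddSubgroup C := (L.comap (AddMonoidHom.inr G H)).addSubgroupOf C
    let f : L →+ A := (AddMonoidHom.fst G H).addSubgroupMap L
    let g : L →+ C := (AddMonoidHom.snd G H).addSubgroupMap L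
    have hf : Function.Surjective f := (AddMonoidHom.fst G H).addSubgroupMap_surjective L
    have hg : Function.Surjective g := (AddMonoidHom.snd G H).addSubgroupMap_surjective L
    let f' : L →+ A ⧸ B := (QuotientAddGroup.mk' B).comp f
    let g' : L →+ C ⧸ D := (QuotientAddGroup.mk' D).comp g
    have hf' : Function.Surjective f' := (QuotientAddGroup.mk'_surjective B).comp hf
    have hg' : Function.Surjective g' := (QuotientAddGroup.mk'_surjective D).comp hg
    -- Since `(x, y) ∈ L`, the conditions `(x, 0) ∈ L` and `(0, y) ∈ L` are equivalent. Both
    -- sections are thus quotients of `L` by one kernel, which yields `e`.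
    have hker : f'.ker = g'.ker := by
      ext x
      have h1 : x ∈ f'.ker ↔ ((x : G × H).1, (0 : H)) ∈ L :=
        QuotientAddGroup.eq_zero_iff (f x)
      have h2 : x ∈ g'.ker ↔ ((0 : G), (x : G × H).2) ∈ L :=
        QuotientAddGroup.eq_zero_iff (g x)
      rw [h1, h2]
      have h3 : (x : G × H) - ((x : G × H).1, (0 : H)) = ((0 : G), (x : G × H).2) := by
        ext <;> simp
      have h4 : (x : G × H) - ((0 : G), (x : G × H).2) = ((x : G × H).1, (0 : H)) := by
        ext <;> simp
      exact ⟨fun h => h3 ▸ L.sub_mem x.2 h, fun h => h4 ▸ L.sub_mem x.2 h⟩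
    let e : A ⧸ B ≃+ C ⧸ D :=
      (QuotientAddGroup.quotientKerEquivOfSurjective f' hf').symm.trans
        ((QuotientAddGroup.quotientAddEquivOfEq hker).trans
          (QuotientAddGroup.quotientKerEquivOfSurjective g' hg'))
    have he : ∀ x : L, e (f x : A ⧸ B) = (g x : C ⧸ D) := by
      intro x
      have : (QuotientAddGroup.quotientKerEquivOfSurjective f' hf').symm (f x : A ⧸ B) =
          (x : L ⧸ f'.ker) := by
        rw [AddEquiv.symm_apply_eq]
        rfl
      simp only [e, AddEquiv.trans_apply, this]
      rfl
    refine ⟨⟨A, B, C, D, e⟩, ?_⟩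
    ext ⟨x, y⟩
    constructor
    · rintro ⟨a, c, h, h1, h2⟩
      obtain ⟨l, rfl⟩ := hf a
      have h3 : -g l + c ∈ D := by rw [← QuotientAddGroup.eq, ← he, h]
      have h4 : ((0 : G), ((-g l + c : C) : H)) ∈ L := h3
      have h5 := L.add_mem l.2 h4
      have h6 : (l : G × H) + ((0 : G), ((-g l + c : C) : H)) = (x, y) := by
        ext
        · rw [Prod.fst_add, add_zero]
          exact h1
        · simp only [AddSubgroup.coe_add, Prod.snd_add, h2]
          have : ((g l : C) : H) = (l : G × H).2 := rfl
          simp [this]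
      rwa [h6] at h5
    · intro h
      exact ⟨f ⟨_, h⟩, g ⟨_, h⟩, he _, rfl, rfl⟩

noncomputable instance AddSubgroup.fintypeOfFinite (G : Type*) [AddGroup G] [Finite G] :
    Fintype (AddSubgroup G) :=
  Fintype.ofFinite _

instance AddEquiv.finiteOfFinite (M N : Type*) [Add M] [Add N] [Finite M] [Finite N] :
    Finite (M ≃+ N) :=
  Finite.of_injective (fun e : M ≃+ N => (e : M → N)) DFunLike.coe_injective

theorem sum_addSubgroup_prod [Finite G] [Finite H] (f : AddSubgroup (G × H) → ℕ)
    (f' : ∀ (A : AddSubgroup G) (_ : AddSubgroup A) (C : AddSubgroup H) (_ : AddSubgroup C), ℕ)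
    (hf : ∀ A B C D e, f (goursatSubgroup A B C D e) = f' A B C D) :
    ∑ L, f L =
      ∑ A : AddSubgroup G, ∑ B : AddSubgroup A, ∑ C : AddSubgroup H, ∑ D : AddSubgroup C,
        Nat.card (A ⧸ B ≃+ C ⧸ D) * f' A B C D := by
  have (A : AddSubgroup G) (B : AddSubgroup A) (C : AddSubgroup H) (D : AddSubgroup C) :
      Fintype (A ⧸ B ≃+ C ⧸ D) := Fintype.ofFinite _
  rw [← goursatSubgroup_bijective.sum_comp f]
  simp only [Fintype.sum_sigma, hf, Finset.sum_const, Finset.card_univ, Nat.card_eq_fintype_card,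
    smul_eq_mul]

theorem card_addSubgroup_prod [Finite G] [Finite H] (n : ℕ) :
    Nat.card {L : AddSubgroup (G × H) // Nat.card L = n} =
      ∑ A : AddSubgroup G, ∑ B : AddSubgroup A, ∑ C : AddSubgroup H, ∑ D : AddSubgroup C,
        Nat.card (A ⧸ B ≃+ C ⧸ D) * if Nat.card A * Nat.card D = n then 1 else 0 := by
  rw [Nat.card_eq_fintype_card, Fintype.card_subtype, Finset.card_filter]
  exact sum_addSubgroup_prod _ _ fun A B C D e => by rw [card_goursatSubgroup]

end Goursat

/-! ### Cyclic `p`-groups and products of two of them. -/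

section Cyclic

variable {M N : Type*} [AddCommGroup M] [AddCommGroup N]

/-- `A` is killed by its order, and in a cyclic group that kernel has no more than `Nat.card A`
elements. -/
theorem AddSubgroup.eq_ker_nsmul_of_isAddCyclic [Finite M] [IsAddCyclic M] (A : AddSubgroup M) :
    A = (nsmulAddMonoidHom (Nat.card A) : M →+ M).ker := by
  refine AddSubgroup.eq_of_le_of_card_ge (fun x hx => ?_) ?_
  · exact congrArg (Subtype.val) (card_nsmul_eq_zero' (x := (⟨x, hx⟩ : A)))
  · rw [IsAddCyclic.card_nsmulAddMonoidHom_ker, Nat.gcd_eq_right A.card_addSubgroup_dvd_card]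

theorem sum_addSubgroup_of_isAddCyclic [Finite M] [IsAddCyclic M] {p n : ℕ} (hp : p.Prime)
    (hM : Nat.card M = p ^ n) (f : AddSubgroup M → ℕ) (f' : ℕ × ℕ → ℕ)
    (hf : ∀ (A : AddSubgroup M) i j, i + j = n → Nat.card A = p ^ i → Nat.card (M ⧸ A) = p ^ j → f A = f' (i, j)) :
    ∑ A, f A = ∑ x ∈ Finset.HasAntidiagonal.antidiagonal n, f' x := by
  have hcard : ∀ x ∈ Finset.HasAntidiagonal.antidiagonal n,
      Nat.card (nsmulAddMonoidHom (p ^ x.1) : M →+ M).ker = p ^ x.1 := by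
    intro x hx
    rw [IsAddCyclic.card_nsmulAddMonoidHom_ker, hM, ← Finset.HasAntidiagonal.mem_antidiagonal.1 hx,
      Nat.gcd_eq_right (pow_dvd_pow _ (Nat.le_add_right _ _))]
  symm
  refine Finset.sum_bij (fun x _ => (nsmulAddMonoidHom (p ^ x.1) : M →+ M).ker)
    (fun _ _ => Finset.mem_univ _) ?_ ?_ ?_
  · intro x hx y hy h
    have h1 := hcard x hx
    rw [h, hcard y hy] at h1
    have h2 : y.1 = x.1 := Nat.pow_right_injective hp.two_le h1
    rw [Finset.HasAntidiagonal.mem_antidiagonal] at hx hy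
    ext <;> omega
  · intro A _
    obtain ⟨i, hi, h⟩ := (Nat.dvd_prime_pow hp).1 (hM ▸ A.card_addSubgroup_dvd_card)
    refine ⟨(i, n - i), Finset.HasAntidiagonal.mem_antidiagonal.2 (Nat.add_sub_of_le hi), ?_⟩
    rw [A.eq_ker_nsmul_of_isAddCyclic, h]
  · intro x hx
    have h := (nsmulAddMonoidHom (p ^ x.1) : M →+ M).ker.card_eq_card_quotient_mul_card_addSubgroup
    rw [hcard x hx, hM, ← Finset.HasAntidiagonal.mem_antidiagonal.1 hx, add_comm, pow_add] at h
    exact (hf _ _ _ (Finset.HasAntidiagonal.mem_antidiagonal.1 hx) (hcard x hx)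
      (Nat.eq_of_mul_eq_mul_right (pow_pos hp.pos _) h).symm).symm

theorem Nat.card_addEquiv_congr {M' N' : Type*} [AddCommGroup M'] [AddCommGroup N']
    (e : M ≃+ M') (e' : N ≃+ N') : Nat.card (M ≃+ N) = Nat.card (M' ≃+ N') :=
  Nat.card_congr
    { toFun := fun f => e.symm.trans (f.trans e')
      invFun := fun f => e.trans (f.trans e'.symm)
      left_inv := fun f => by ext; simp
      right_inv := fun f => by ext; simp }

theorem IsAddCyclic.card_addAut [Finite M] [IsAddCyclic M] :
    Nat.card (M ≃+ M) = (Nat.card M).totient := by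
  have h := IsCyclic.card_mulAut (Multiplicative M)
  rw [← Nat.card_congr Multiplicative.toAdd.symm] at h
  rw [← h]
  exact Nat.card_congr AddEquiv.toMultiplicative

theorem card_addEquiv_of_isAddCyclic [Finite M] [Finite N] [IsAddCyclic M] [IsAddCyclic N]
    {p i j : ℕ} (hp : p.Prime) (hM : Nat.card M = p ^ i) (hN : Nat.card N = p ^ j) :
    Nat.card (M ≃+ N) = if i = j then (p ^ i).totient else 0 := by
  split_ifs with h
  · subst h
    rw [← hM, ← IsAddCyclic.card_addAut]
    exact Nat.card_addEquiv_congr (AddEquiv.refl _)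
      (addEquivOfAddCyclicCardEq (hN.trans hM.symm))
  · refine Nat.card_eq_zero.2 (Or.inl ⟨fun e => h ?_⟩)
    exact Nat.pow_right_injective hp.two_le (hM.symm.trans ((Nat.card_congr e.toEquiv).trans hN))

/-- The exponent of the group determines `v`, and its order determines `u + v`. -/
theorem eq_and_eq_of_zmod_prod_addEquiv {p u v u' v' : ℕ} (hp : p.Prime) (huv : u ≤ v)
    (huv' : u' ≤ v')
    (e : ZMod (p ^ u) × ZMod (p ^ v) ≃+ ZMod (p ^ u') × ZMod (p ^ v')) : u = u' ∧ v = v' := by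
  have h1 := AddMonoid.exponent_eq_of_addEquiv e
  have h2 := Nat.card_congr e.toEquiv
  have inj := Nat.pow_right_injective hp.two_le
  simp only [AddMonoid.exponent_prod, ZMod.exponent, lcm_eq_nat_lcm,
    Nat.lcm_eq_right (pow_dvd_pow p huv), Nat.lcm_eq_right (pow_dvd_pow p huv')] at h1
  simp only [Nat.card_prod, Nat.card_zmod, ← pow_add] at h2
  have h3 : v = v' := inj h1
  have h4 : u + v = u' + v' := inj h2
  omega

theorem card_addEquiv_of_rank_two {p u v u' v' : ℕ} (hp : p.Prime) (huv : u ≤ v) (huv' : u' ≤ v')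
    (e : M ≃+ ZMod (p ^ u) × ZMod (p ^ v)) (e' : N ≃+ ZMod (p ^ u') × ZMod (p ^ v')) :
    Nat.card (M ≃+ N) = if u = u' ∧ v = v' then numAutomorphisms (p ^ u) (p ^ v) else 0 := by
  rw [Nat.card_addEquiv_congr e e']
  split_ifs with h
  · obtain ⟨rfl, rfl⟩ := h
    rfl
  · exact Nat.card_eq_zero.2 (Or.inl ⟨fun e => h (eq_and_eq_of_zmod_prod_addEquiv hp huv huv' e)⟩)

theorem nonempty_addEquiv_zmod_prod {m n : ℕ} (hm : m ≠ 0) (hn : n ≠ 0)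
    (hM : Nat.card M = m * n) (g h : M) (hg : m • g = 0) (hh : n • h = 0)
    (hgen : ∀ x : M, ∃ i j : ℤ, x = i • g + j • h) : Nonempty (M ≃+ ZMod m × ZMod n) := by
  have : NeZero m := ⟨hm⟩
  have : NeZero n := ⟨hn⟩
  let α : ZMod m →+ M := ZMod.lift m ⟨(zmultiplesHom M) g, by simpa using hg⟩
  let β : ZMod n →+ M := ZMod.lift n ⟨(zmultiplesHom M) h, by simpa using hh⟩
  let γ : ZMod m × ZMod n →+ M := α.coprod β
  have hs : Function.Surjective γ := by
    intro x
    obtain ⟨i, j, rfl⟩ := hgen x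
    exact ⟨((i : ZMod m), (j : ZMod n)), by simp [γ, α, β]⟩
  have hb : Function.Bijective γ := by
    refine (Nat.bijective_iff_surjective_and_card γ).2 ⟨hs, ?_⟩
    rw [hM, Nat.card_prod, Nat.card_zmod, Nat.card_zmod]
  exact ⟨(AddEquiv.ofBijective γ hb).symm⟩

end Cyclic

/-! ### Types of subgroups and quotients of a product of two cyclic `p`-groups. -/

section RankTwo

variable {G H : Type*} [AddCommGroup G] [AddCommGroup H]

/-- Generators are `(0, d)`, with `d` generating `D`, and `(g, c)`, with `g` generating `A` and `c`
a lift of `e g`. The bound `k ≤ i` makes `p ^ (j + i)` kill `c`. -/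
theorem nonempty_goursatSubgroup_addEquiv_of_le [Finite G] [Finite H] [IsAddCyclic G]
    [IsAddCyclic H] {p i j k : ℕ} (hp : p.Prime) {A : AddSubgroup G} {B : AddSubgroup A}
    {C : AddSubgroup H} {D : AddSubgroup C} (e : A ⧸ B ≃+ C ⧸ D) (hA : Nat.card A = p ^ (j + i))
    (hC : Nat.card C = p ^ (j + k)) (hD : Nat.card D = p ^ k) (hki : k ≤ i) :
    Nonempty (goursatSubgroup A B C D e ≃+ ZMod (p ^ k) × ZMod (p ^ (j + i))) := by
  obtain ⟨g, hg⟩ := IsAddCyclic.exists_generator (α := A)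
  obtain ⟨d, hd⟩ := IsAddCyclic.exists_generator (α := D)
  obtain ⟨c, hc⟩ := exists_mk_eq_apply e g
  refine nonempty_addEquiv_zmod_prod (pow_pos hp.pos _).ne' (pow_pos hp.pos _).ne' ?_
    ⟨_, zero_coe_mem_goursatSubgroup.2 d.2⟩ ⟨_, coe_mem_goursatSubgroup.2 hc⟩ ?_ ?_ ?_
  · rw [card_goursatSubgroup, hA, hD, mul_comm]
  · ext
    · simp
    · have : p ^ k • d = 0 := by rw [← hD]; exact card_nsmul_eq_zero'
      simpa using congrArg (fun x : D => ((x : C) : H)) this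
  · ext
    · have : p ^ (j + i) • g = 0 := by rw [← hA]; exact card_nsmul_eq_zero'
      simpa using congrArg (fun x : A => (x : G)) this
    · have : p ^ (j + i) • c = 0 := by
        obtain ⟨m, hm⟩ := pow_dvd_pow p (Nat.add_le_add_left hki j)
        rw [hm, mul_comm, mul_nsmul', ← hC, card_nsmul_eq_zero', nsmul_zero]
      simpa using congrArg (fun x : C => (x : H)) this
  · rintro ⟨⟨x, y⟩, a, b, h, hx, hy⟩
    obtain rfl : x = a := hx.symm
    obtain rfl : y = b := hy.symm
    obtain ⟨n, rfl⟩ := AddSubgroup.mem_zmultiples_iff.1 (hg a)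
    have hb : -(n • c) + b ∈ D := by
      rw [← QuotientAddGroup.eq, ← h, QuotientAddGroup.mk_zsmul, QuotientAddGroup.mk_zsmul,
        map_zsmul, hc]
    obtain ⟨m, hm⟩ := AddSubgroup.mem_zmultiples_iff.1 (hd ⟨_, hb⟩)
    have hm' : m • ((d : C) : H) = -(n • (c : H)) + b := by
      simpa using congrArg (fun x : D => ((x : C) : H)) hm
    refine ⟨m, n, ?_⟩
    ext
    · simp
    · simp [hm']

/-- With `g`, `h` generating `G`, `H`, the class of `(0, h)` is killed by `p ^ (j + m)`. The class
of `(g, 0)` need not be killed by `p ^ k`, so it is corrected to `(g, s)` with `(p ^ k • g, p ^ k •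
s)` in the subgroup. -/
theorem nonempty_quotient_goursatSubgroup_addEquiv_of_le [Finite G] [Finite H] [IsAddCyclic G]
    [IsAddCyclic H] {p i j k l m : ℕ} (hp : p.Prime) {A : AddSubgroup G} {B : AddSubgroup A}
    {C : AddSubgroup H} {D : AddSubgroup C} (e : A ⧸ B ≃+ C ⧸ D)
    (hG : Nat.card G = p ^ (i + j + k)) (hH : Nat.card H = p ^ (j + l + m))
    (hA : Nat.card A = p ^ (j + i)) (hGA : Nat.card (G ⧸ A) = p ^ k)
    (hC : Nat.card C = p ^ (j + l)) (hCD : Nat.card (C ⧸ D) = p ^ j)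
    (hD : Nat.card D = p ^ l) (hHC : Nat.card (H ⧸ C) = p ^ m) (hkm : k ≤ m) :
    Nonempty ((G × H) ⧸ goursatSubgroup A B C D e ≃+ ZMod (p ^ k) × ZMod (p ^ (j + m))) := by
  obtain ⟨g, hg⟩ := IsAddCyclic.exists_generator (α := G)
  obtain ⟨h, hh⟩ := IsAddCyclic.exists_generator (α := H)
  have hgA : p ^ k • g ∈ A := by
    rw [← QuotientAddGroup.eq_zero_iff, QuotientAddGroup.mk_nsmul, ← hGA, card_nsmul_eq_zero']
  have hhC : p ^ m • h ∈ C := by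
    rw [← QuotientAddGroup.eq_zero_iff, QuotientAddGroup.mk_nsmul, ← hHC, card_nsmul_eq_zero']
  have hhD : p ^ j • (⟨_, hhC⟩ : C) ∈ D := by
    rw [← QuotientAddGroup.eq_zero_iff, QuotientAddGroup.mk_nsmul, ← hCD, card_nsmul_eq_zero']
  obtain ⟨c, hc⟩ := exists_mk_eq_apply e ⟨_, hgA⟩
  -- As `p ^ (j + l)` kills `c` and `H` is cyclic of order `p ^ (j + l + m)`, `c` is divisible by `p
  -- ^ m`, hence by `p ^ k`.
  obtain ⟨s, hs⟩ : ∃ s : H, p ^ k • s = c := by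
    obtain ⟨n, hn⟩ := AddSubgroup.mem_zmultiples_iff.1 (hh c)
    have h1 : p ^ (j + l) • c = 0 := by rw [← hC]; exact card_nsmul_eq_zero'
    have h2 : (((p ^ (j + l) : ℕ) : ℤ) * n) • h = 0 := by
      rw [mul_zsmul, hn, natCast_zsmul]
      exact congrArg Subtype.val h1
    rw [← addOrderOf_dvd_iff_zsmul_eq_zero, addOrderOf_eq_card_of_forall_mem_zmultiples hh, hH,
      pow_add, Nat.cast_mul] at h2
    obtain ⟨q, hq⟩ := Int.dvd_of_mul_dvd_mul_left
      (by exact_mod_cast (pow_pos hp.pos _).ne') h2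
    refine ⟨((p ^ (m - k) : ℕ) * q) • h, ?_⟩
    rw [← hn, hq, ← natCast_zsmul, ← mul_zsmul, ← mul_assoc, ← Nat.cast_mul, ← pow_add,
      Nat.add_sub_of_le hkm]
  refine nonempty_addEquiv_zmod_prod (pow_pos hp.pos _).ne' (pow_pos hp.pos _).ne' ?_
    (((g, s) : G × H) : (G × H) ⧸ goursatSubgroup A B C D e)
    (((0, h) : G × H) : (G × H) ⧸ goursatSubgroup A B C D e) ?_ ?_ ?_
  · have h1 := (goursatSubgroup A B C D e).card_eq_card_quotient_mul_card_addSubgroup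
    rw [card_goursatSubgroup, Nat.card_prod, hG, hH, hA, hD, ← pow_add, ← pow_add] at h1
    rw [← pow_add]
    refine Nat.eq_of_mul_eq_mul_right (pow_pos hp.pos (j + i + l)) ?_
    rw [← h1, ← pow_add]
    congr 1
    omega
  · rw [← QuotientAddGroup.mk_nsmul, QuotientAddGroup.eq_zero_iff, Prod.smul_mk, hs]
    exact coe_mem_goursatSubgroup.2 hc
  · rw [← QuotientAddGroup.mk_nsmul, QuotientAddGroup.eq_zero_iff, Prod.smul_mk, smul_zero,
      pow_add, mul_nsmul']
    exact zero_coe_mem_goursatSubgroup.2 hhD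
  · intro x
    obtain ⟨⟨x, y⟩, rfl⟩ := QuotientAddGroup.mk_surjective x
    obtain ⟨n, rfl⟩ := AddSubgroup.mem_zmultiples_iff.1 (hg x)
    obtain ⟨r, hr⟩ := AddSubgroup.mem_zmultiples_iff.1 (hh (y - n • s))
    refine ⟨n, r, ?_⟩
    rw [← QuotientAddGroup.mk_zsmul, ← QuotientAddGroup.mk_zsmul, ← QuotientAddGroup.mk_add]
    congr 1
    ext
    · simp
    · simp [hr]

/-- The tuples `(x₁, …, x₅)` with `x₁ + x₂ + x₃ = a` and `x₃ + x₄ + x₅ = b`. -/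
def sectionExponents (a b : ℕ) : Finset (Fin 5 → ℕ) :=
  {x ∈ Fintype.piFinset fun _ => Finset.range (a + b + 1) |
    x 0 + x 1 + x 2 = a ∧ x 2 + x 3 + x 4 = b}

theorem mem_sectionExponents {a b : ℕ} {x : Fin 5 → ℕ} :
    x ∈ sectionExponents a b ↔ x 0 + x 1 + x 2 = a ∧ x 2 + x 3 + x 4 = b := by
  rw [sectionExponents, Finset.mem_filter, and_iff_right_iff_imp]
  rintro ⟨h1, h2⟩
  simp only [Fintype.mem_piFinset, Finset.mem_range, Fin.forall_fin_succ]
  simp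
  omega

section

variable {A : AddSubgroup G} {B : AddSubgroup A} {C : AddSubgroup H} {D : AddSubgroup C}
  (e : A ⧸ B ≃+ C ⧸ D)

/-- Swapping the factors of `G × H` exchanges the two sections. -/
def goursatSubgroupSwap : goursatSubgroup A B C D e ≃+ goursatSubgroup C D A B e.symm :=
  ((AddEquiv.prodComm : G × H ≃+ H × G).addSubgroupMap _).trans
    (AddEquiv.addSubgroupCongr map_prodComm_goursatSubgroup)

/-- Swapping the factors of `G × H`, on the quotients. -/
def quotientGoursatSubgroupSwap :
    (G × H) ⧸ goursatSubgroup A B C D e ≃+ (H × G) ⧸ goursatSubgroup C D A B e.symm :=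
  QuotientAddGroup.congr _ _ AddEquiv.prodComm map_prodComm_goursatSubgroup

end

theorem nonempty_goursatSubgroup_addEquiv [Finite G] [Finite H] [IsAddCyclic G] [IsAddCyclic H]
    {p i j k : ℕ} (hp : p.Prime) {A : AddSubgroup G} {B : AddSubgroup A}
    {C : AddSubgroup H} {D : AddSubgroup C} (e : A ⧸ B ≃+ C ⧸ D) (hA : Nat.card A = p ^ (j + i))
    (hB : Nat.card B = p ^ i) (hC : Nat.card C = p ^ (j + k)) (hD : Nat.card D = p ^ k) :
    Nonempty (goursatSubgroup A B C D e ≃+ ZMod (p ^ min i k) × ZMod (p ^ (j + max i k))) := by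
  rcases le_total k i with h | h
  · rw [min_eq_right h, max_eq_left h]
    exact nonempty_goursatSubgroup_addEquiv_of_le hp e hA hC hD h
  · rw [min_eq_left h, max_eq_right h]
    obtain ⟨f⟩ := nonempty_goursatSubgroup_addEquiv_of_le hp e.symm hC hA hB h
    exact ⟨(goursatSubgroupSwap e).trans f⟩

theorem nonempty_quotient_goursatSubgroup_addEquiv [Finite G] [Finite H] [IsAddCyclic G]
    [IsAddCyclic H] {p i j k l m : ℕ} (hp : p.Prime) {A : AddSubgroup G} {B : AddSubgroup A}
    {C : AddSubgroup H} {D : AddSubgroup C} (e : A ⧸ B ≃+ C ⧸ D)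
    (hG : Nat.card G = p ^ (j + i + k)) (hH : Nat.card H = p ^ (j + l + m))
    (hA : Nat.card A = p ^ (j + i)) (hGA : Nat.card (G ⧸ A) = p ^ k)
    (hB : Nat.card B = p ^ i) (hAB : Nat.card (A ⧸ B) = p ^ j)
    (hC : Nat.card C = p ^ (j + l)) (hHC : Nat.card (H ⧸ C) = p ^ m)
    (hD : Nat.card D = p ^ l) (hCD : Nat.card (C ⧸ D) = p ^ j) :
    Nonempty ((G × H) ⧸ goursatSubgroup A B C D e ≃+
      ZMod (p ^ min k m) × ZMod (p ^ (j + max k m))) := by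
  rcases le_total k m with h | h
  · rw [min_eq_left h, max_eq_right h]
    exact nonempty_quotient_goursatSubgroup_addEquiv_of_le hp e (by rw [hG, add_comm i]) hH hA hGA
      hC hCD hD hHC h
  · rw [min_eq_right h, max_eq_left h]
    obtain ⟨f⟩ := nonempty_quotient_goursatSubgroup_addEquiv_of_le hp e.symm
      (by rw [hH, add_comm l]) hG hC hHC hA hAB hB hGA h
    exact ⟨(quotientGoursatSubgroupSwap e).trans f⟩

end RankTwo

/-! ### Sums over subgroups as sums over exponents. -/

section Count

open Finset

/-- The entries of `x` are the exponents of `|B|`, `|G ⧸ A|`, `|A ⧸ B| = |C ⧸ D|`, `|D|`, `|H ⧸ C|`,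
in this order. -/
theorem sum_antidiagonal_eq_sum_sectionExponents (a b : ℕ) (φ : ℕ → ℕ) (f : (Fin 5 → ℕ) → ℕ) :
    ∑ α ∈ HasAntidiagonal.antidiagonal a, ∑ β ∈ HasAntidiagonal.antidiagonal α.1,
      ∑ γ ∈ HasAntidiagonal.antidiagonal b, ∑ δ ∈ HasAntidiagonal.antidiagonal γ.1,
        (if β.2 = δ.2 then φ β.2 else 0) * f ![β.1, α.2, β.2, δ.1, γ.2] =
      ∑ x ∈ sectionExponents a b, φ (x 2) * f x := by
  simp only [Finset.sum_sigma', ite_mul, zero_mul]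
  rw [← Finset.sum_filter]
  refine Finset.sum_nbij'
    (fun q => ![q.2.1.1, q.1.2, q.2.1.2, q.2.2.2.1, q.2.2.1.2])
    (fun x => ⟨(x 0 + x 2, x 1), (x 0, x 2), (x 3 + x 2, x 4), (x 3, x 2)⟩) ?_ ?_ ?_ ?_ ?_
  · rintro ⟨⟨α, k⟩, ⟨i, j⟩, ⟨γ, m⟩, ⟨l, j'⟩⟩ h
    simp only [mem_filter, mem_sigma, HasAntidiagonal.mem_antidiagonal] at h
    rw [mem_sectionExponents]
    simp
    omega
  · intro x h
    rw [mem_sectionExponents] at h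
    simp only [mem_filter, mem_sigma, HasAntidiagonal.mem_antidiagonal]
    obtain ⟨h1, h2⟩ := h
    refine ⟨⟨?_, trivial, ?_, trivial⟩, trivial⟩ <;> omega
  · rintro ⟨⟨α, k⟩, ⟨i, j⟩, ⟨γ, m⟩, ⟨l, j'⟩⟩ h
    simp only [mem_filter, mem_sigma, HasAntidiagonal.mem_antidiagonal] at h
    obtain ⟨⟨h1, h2, h3, h4⟩, h5⟩ := h
    subst h5
    obtain rfl : i + j = α := by omega
    obtain rfl : l + j = γ := by omega
    rfl
  · intro x h
    ext i
    fin_cases i <;> rfl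
  · intro q h
    rfl

theorem AddSubgroup.exists_card_eq_pow {M : Type*} [AddCommGroup M] (A : AddSubgroup M) {p n : ℕ}
    (hp : p.Prime) (hM : Nat.card M = p ^ n) :
    ∃ i j, i + j = n ∧ Nat.card A = p ^ i ∧ Nat.card (M ⧸ A) = p ^ j := by
  have h := A.card_eq_card_quotient_mul_card_addSubgroup
  rw [hM] at h
  obtain ⟨i, -, hi⟩ := (Nat.dvd_prime_pow hp).1 (Dvd.intro_left _ h.symm)
  obtain ⟨j, -, hj⟩ := (Nat.dvd_prime_pow hp).1 (Dvd.intro _ h.symm)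
  rw [hi, hj, ← pow_add] at h
  exact ⟨i, j, (add_comm i j).trans (Nat.pow_right_injective hp.two_le h).symm, hi, hj⟩

theorem sum_addSubgroup_prod_of_isAddCyclic {G H : Type*} [AddCommGroup G] [AddCommGroup H]
    [Finite G] [Finite H] [IsAddCyclic G] [IsAddCyclic H] {p a b : ℕ} (hp : p.Prime)
    (hG : Nat.card G = p ^ a) (hH : Nat.card H = p ^ b) (f : AddSubgroup (G × H) → ℕ)
    (f' : (Fin 5 → ℕ) → ℕ)
    (hf : ∀ L : AddSubgroup (G × H), ∀ x ∈ sectionExponents a b, Nat.card L = p ^ (x 0 + x 2 + x 3) →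
      Nonempty (L ≃+ ZMod (p ^ min (x 0) (x 3)) × ZMod (p ^ (x 2 + max (x 0) (x 3)))) →
      Nonempty ((G × H) ⧸ L ≃+ ZMod (p ^ min (x 1) (x 4)) × ZMod (p ^ (x 2 + max (x 1) (x 4)))) →
      f L = f' x) :
    ∑ L, f L = ∑ x ∈ sectionExponents a b, (p ^ x 2).totient * f' x := by
  have hlog (n : ℕ) : Nat.log p (p ^ n) = n := Nat.log_pow hp.one_lt n
  -- `Nat.log p` recovers the exponents from the orders, so that the summand becomes a function of
  -- the four subgroups.
  rw [sum_addSubgroup_prod f (fun A B C D => f' ![Nat.log p (Nat.card B),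
    Nat.log p (Nat.card (G ⧸ A)), Nat.log p (Nat.card (A ⧸ B)), Nat.log p (Nat.card D),
    Nat.log p (Nat.card (H ⧸ C))])]
  · rw [← sum_antidiagonal_eq_sum_sectionExponents a b (fun n => (p ^ n).totient) f']
    refine sum_addSubgroup_of_isAddCyclic hp hG _ _ fun A α k hα hA hGA => ?_
    refine sum_addSubgroup_of_isAddCyclic hp hA _ _ fun B i j hij hB hAB => ?_
    refine sum_addSubgroup_of_isAddCyclic hp hH _ _ fun C γ m hγ hC hHC => ?_
    refine sum_addSubgroup_of_isAddCyclic hp hC _ _ fun D l j' hlj hD hCD => ?_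
    have : IsAddCyclic (A ⧸ B) :=
      isAddCyclic_of_surjective _ (QuotientAddGroup.mk'_surjective B)
    have : IsAddCyclic (C ⧸ D) :=
      isAddCyclic_of_surjective _ (QuotientAddGroup.mk'_surjective D)
    simp only [card_addEquiv_of_isAddCyclic hp hAB hCD, hB, hGA, hAB, hD, hHC, hlog]
  · intro A B C D e
    obtain ⟨α, k, hα, hA, hGA⟩ := A.exists_card_eq_pow hp hG
    obtain ⟨i, j, hij, hB, hAB⟩ := B.exists_card_eq_pow hp hA
    obtain ⟨γ, m, hγ, hC, hHC⟩ := C.exists_card_eq_pow hp hH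
    obtain ⟨l, j', hlj, hD, hCD⟩ := D.exists_card_eq_pow hp hC
    obtain rfl : j = j' := Nat.pow_right_injective hp.two_le
      (hAB.symm.trans ((Nat.card_congr e.toEquiv).trans hCD))
    simp only [hB, hGA, hAB, hD, hHC, hlog]
    subst hij hlj hα hγ
    rw [add_comm i j] at hA hG
    rw [add_comm l j] at hC hH
    refine hf _ _ ?_ ?_ ?_ ?_
    · rw [mem_sectionExponents]
      simp
      omega
    · simp [card_goursatSubgroup, hA, hD, pow_add, mul_comm]
    · exact nonempty_goursatSubgroup_addEquiv hp e hA hB hC hD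
    · exact nonempty_quotient_goursatSubgroup_addEquiv hp e hG hH hA hGA hB hAB hC hHC hD hCD

theorem sum_addSubgroup_of_rank_two {M : Type*} [AddCommGroup M] [Finite M] {p a b : ℕ}
    (hp : p.Prime) (e : M ≃+ ZMod (p ^ a) × ZMod (p ^ b)) (f : AddSubgroup M → ℕ)
    (f' : (Fin 5 → ℕ) → ℕ)
    (hf : ∀ L : AddSubgroup M, ∀ x ∈ sectionExponents a b,
      Nat.card L = p ^ (x 0 + x 2 + x 3) →
      Nonempty (L ≃+ ZMod (p ^ min (x 0) (x 3)) × ZMod (p ^ (x 2 + max (x 0) (x 3)))) →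
      Nonempty (M ⧸ L ≃+ ZMod (p ^ min (x 1) (x 4)) × ZMod (p ^ (x 2 + max (x 1) (x 4)))) →
      f L = f' x) :
    ∑ L, f L = ∑ x ∈ sectionExponents a b, (p ^ x 2).totient * f' x := by
  have : NeZero p := ⟨hp.ne_zero⟩
  rw [← e.symm.mapAddSubgroup.toEquiv.sum_comp f]
  refine sum_addSubgroup_prod_of_isAddCyclic hp (Nat.card_zmod _) (Nat.card_zmod _) _ _
    fun L x hx hL ⟨e₁⟩ ⟨e₂⟩ => ?_
  have e₃ : L ≃+ L.map (e.symm : ZMod (p ^ a) × ZMod (p ^ b) →+ M) := e.symm.addSubgroupMap L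
  have e₄ : ((ZMod (p ^ a) × ZMod (p ^ b)) ⧸ L) ≃+
      M ⧸ L.map (e.symm : ZMod (p ^ a) × ZMod (p ^ b) →+ M) :=
    QuotientAddGroup.congr _ _ e.symm rfl
  exact hf _ x hx ((Nat.card_congr e₃.symm.toEquiv).trans hL) ⟨e₃.symm.trans e₁⟩
    ⟨e₄.symm.trans e₂⟩

theorem card_addSubgroup_congr {M N : Type*} [AddCommGroup M] [AddCommGroup N] (e : M ≃+ N)
    (n : ℕ) : Nat.card {L : AddSubgroup M // Nat.card L = n} =
      Nat.card {L : AddSubgroup N // Nat.card L = n} :=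
  Nat.card_congr (e.mapAddSubgroup.toEquiv.subtypeEquiv fun L => by
    rw [Nat.card_congr (e.addSubgroupMap L).toEquiv]
    rfl)

end Count

/-! ### Assembling the twenty exponents. -/

theorem mem_admissibleTuples {a b c d : ℕ} {w : ExponentTuple} :
    w ∈ admissibleTuples a b c d ↔ w.Admissible a b c d := by
  simp [admissibleTuples]

theorem sum_sectionExponents_eq_sum_admissibleTuples (a b c d k : ℕ) (φ : ℕ → ℕ)
    (F : ℕ → ℕ → ℕ) :
    ∑ x ∈ sectionExponents a b, φ (x 2) *
      ∑ y ∈ sectionExponents (min (x 0) (x 3)) (x 2 + max (x 0) (x 3)), φ (y 2) *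
        ∑ z ∈ sectionExponents c d, φ (z 2) *
          ∑ t ∈ sectionExponents (min (z 0) (z 3)) (z 2 + max (z 0) (z 3)), φ (t 2) *
            ((if min (y 1) (y 4) = min (t 1) (t 4) ∧
                y 2 + max (y 1) (y 4) = t 2 + max (t 1) (t 4)
              then F (min (y 1) (y 4)) (y 2 + max (y 1) (y 4)) else 0) *
              if x 0 + x 2 + x 3 + (t 0 + t 2 + t 3) = k then 1 else 0) =
      ∑ w ∈ admissibleTuples a b c d with w.x₁ + w.x₃ + w.x₄ + w.t₁ + w.t₃ + w.t₄ = k,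
        φ w.x₃ * φ w.y₃ * φ w.z₃ * φ w.t₃ * F w.u w.v := by
  simp only [Finset.mul_sum, Finset.sum_sigma', mul_ite, mul_zero, mul_one,
    ← ite_and]
  rw [← Finset.sum_filter]
  refine Finset.sum_nbij'
    (fun q => ⟨q.1 0, q.1 1, q.1 2, q.1 3, q.1 4, q.2.1 0, q.2.1 1, q.2.1 2, q.2.1 3, q.2.1 4,
      q.2.2.1 0, q.2.2.1 1, q.2.2.1 2, q.2.2.1 3, q.2.2.1 4,
      q.2.2.2 0, q.2.2.2 1, q.2.2.2 2, q.2.2.2 3, q.2.2.2 4⟩)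
    (fun w => ⟨![w.x₁, w.x₂, w.x₃, w.x₄, w.x₅], ![w.y₁, w.y₂, w.y₃, w.y₄, w.y₅],
      ![w.z₁, w.z₂, w.z₃, w.z₄, w.z₅], ![w.t₁, w.t₂, w.t₃, w.t₄, w.t₅]⟩) ?_ ?_ ?_ ?_ ?_
  · rintro ⟨x, y, z, t⟩ h
    simp only [Finset.mem_filter, Finset.mem_sigma, mem_sectionExponents] at h
    obtain ⟨⟨⟨h1, h2⟩, ⟨h3, h4⟩, ⟨h5, h6⟩, h7, h8⟩, h9, h10, h11⟩ := h
    rw [Finset.mem_filter, mem_admissibleTuples]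
    exact ⟨⟨h1, h2, h3, h4, h5, h6, h7, h8, by assumption, by assumption⟩, by simp only; omega⟩
  · intro w h
    rw [Finset.mem_filter, mem_admissibleTuples] at h
    obtain ⟨⟨h1, h2, h3, h4, h5, h6, h7, h8, h9, h10⟩, h11⟩ := h
    simp only [Finset.mem_filter, Finset.mem_sigma, mem_sectionExponents]
    exact ⟨⟨⟨h1, h2⟩, ⟨h3, h4⟩, ⟨h5, h6⟩, h7, h8⟩,
      (by omega : w.x₁ + w.x₃ + w.x₄ + (w.t₁ + w.t₃ + w.t₄) = k), h9, h10⟩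
  · rintro ⟨x, y, z, t⟩ h
    have eta (x : Fin 5 → ℕ) : ![x 0, x 1, x 2, x 3, x 4] = x := by
      ext i
      fin_cases i <;> rfl
    simp only [eta]
  · intro w h
    rfl
  · rintro ⟨x, y, z, t⟩ h
    simp only [ExponentTuple.u, ExponentTuple.v, mul_assoc]

theorem mainTheorem8 (p : ℕ) (hp : p.Prime) (a b c d k : ℕ) (hk : k ≤ a + b + c + d) :
    numSubgroupsOfOrder (p ^ a) (p ^ b) (p ^ c) (p ^ d) (p ^ k) =
      ∑ w ∈ admissibleTuples a b c d with w.x₁ + w.x₃ + w.x₄ + w.t₁ + w.t₃ + w.t₄ = k,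
        Nat.totient (p ^ w.x₃) * Nat.totient (p ^ w.y₃) *
          Nat.totient (p ^ w.z₃) * Nat.totient (p ^ w.t₃) *
          numAutomorphisms (p ^ w.u) (p ^ w.v) := by
  have : NeZero p := ⟨hp.ne_zero⟩
  rw [← sum_sectionExponents_eq_sum_admissibleTuples a b c d k (fun n => (p ^ n).totient)
    (fun u v => numAutomorphisms (p ^ u) (p ^ v)), numSubgroupsOfOrder,
    card_addSubgroup_congr AddEquiv.prodAssoc.symm, card_addSubgroup_prod]
  -- For `A` and `C` the type of the subgroup is kept, as the ambient group of the next sum; for `B`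
  -- and `D` the type of the quotient, for counting isomorphisms.
  refine sum_addSubgroup_of_rank_two hp (AddEquiv.refl _) _ _ fun A x hx hA ⟨eA⟩ _ => ?_
  refine sum_addSubgroup_of_rank_two hp eA _ _ fun B y hy hB _ ⟨eB⟩ => ?_
  refine sum_addSubgroup_of_rank_two hp (AddEquiv.refl _) _ _ fun C z hz hC ⟨eC⟩ _ => ?_
  refine sum_addSubgroup_of_rank_two hp eC _ _ fun D t ht hD _ ⟨eD⟩ => ?_
  rw [card_addEquiv_of_rank_two hp (by omega) (by omega) eB eD, hA, hD, ← pow_add]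
  simp only [(Nat.pow_right_injective hp.two_le).eq_iff]
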